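/- Let $G$ be a finite group. A \emph{Fitting set} of $G$ is a nonempty set $\mathcal F$ of subgroups of $G$ such that: (i) if $T\trianglelefteq S\in\mathcal F$, then $T\in\mathcal F$; (ii) if $S,T\in\mathcal F$ and $S$, $T$ are both normal in $ST$, then $ST\in\mathcal F$; (iii) if $S\in\mathcal F$ and $x\in G$, then $S^x\in\mathcal F$. For a set $\mathcal F$ of subgroups of $G$ and $H\le G$, let $H_{\mathcal F}$ be the product of all normal subgroups of $H$ that belong to $\mathcal F$, and for a class $\mathfrak F$ of groups put $\mathcal F\circ\mathfrak F=\{H\le G : H/H_{\mathcal F}\in\mathfrak F\}$. A subgroup $V$ of $N\le G$ is \emph{$\mathcal F$-maximal} in $N$ if $V\in\mathcal F$ and $U=V$ whenever $V\le U\le N$ and $U\in\mathcal F$; $V\le G$ is an \emph{$\mathcal F$-injector} of $G$ if $V\cap N$ is $\mathcal F$-maximal in $N$ for every subnormal subgroup $N$ of $G$. A \emph{nilpotent injector} of a group is an injector for the set of all its nilpotent subgroups. Let $\mathfrak N$ and $\mathfrak S$ be the classes of nilpotent and of soluble groups. Let $\mathcal X$ be a Fitting set of $G$ with $G\in\mathcal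 X\circ\mathfrak S$, that is, $G/G_{\mathcal X}$ is soluble, and let $\mathcal H=\mathcal X\circ\mathfrak N$. Then $\mathcal H$ is a Fitting set of $G$, and: (1) a subgroup $V$ of $G$ is an $\mathcal H$-injector of $G$ if and only if $G_{\mathcal X}\le V$ and $V/G_{\mathcal X}$ is a nilpotent injector of $G/G_{\mathcal X}$; (2) the set of all $\mathcal H$-injectors of $G$ is exactly the set of all subgroups $V$ of $G$ such that $G_{\mathcal H}\le V$ and $V$ is $\mathcal H$-maximal in $G$. -/

import Mathlib

namespace FittingSets

universe u

variable {G : Type u} [Group G]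

/-- `𝓕` is a Fitting set of `G`: a nonempty set of subgroups of `G` closed under normal subgroups,
under products `ST` of members `S`, `T` that are normal in `ST`, and under conjugation in `G`.
If `S` is normal in `S ⊔ T`, then `S ⊔ T` is the product `ST`. -/
structure IsFittingSet (𝓕 : Set (Subgroup G)) : Prop where
  nonempty : 𝓕.Nonempty
  normal_mem : ∀ S T : Subgroup G, S ∈ 𝓕 → T ≤ S → (T.subgroupOf S).Normal → T ∈ 𝓕
  mul_mem : ∀ S T : Subgroup G, S ∈ 𝓕 → T ∈ 𝓕 →
    (S.subgroupOf (S ⊔ T)).Normal → (T.subgroupOf (S ⊔ T)).Normal → S ⊔ T ∈ 𝓕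
  conj_mem : ∀ (S : Subgroup G) (x : G), S ∈ 𝓕 → S.map (MulAut.conj x).toMonoidHom ∈ 𝓕

/-- The radical `H_𝓕` of a subgroup `H ≤ G`: the product of all normal subgroups of `H` that belong
to `𝓕`, as a subgroup of `G`. -/
def radical (𝓕 : Set (Subgroup G)) (H : Subgroup G) : Subgroup G :=
  sSup {K | K ≤ H ∧ (K.subgroupOf H).Normal ∧ K ∈ 𝓕}

theorem radical_le (𝓕 : Set (Subgroup G)) (H : Subgroup G) : radical 𝓕 H ≤ H :=
  sSup_le fun _ hK => hK.1

instance radical_subgroupOf_normal (𝓕 : Set (Subgroup G)) (H : Subgroup G) :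
    ((radical 𝓕 H).subgroupOf H).Normal := by
  have h : (radical 𝓕 H).subgroupOf H =
      sSup {L : Subgroup H | L.Normal ∧ L.map H.subtype ∈ 𝓕} := by
    apply Subgroup.map_injective H.subtype_injective
    rw [Subgroup.map_subgroupOf_eq_of_le (radical_le 𝓕 H)]
    apply le_antisymm
    · refine sSup_le fun K hK => ?_
      rw [← Subgroup.map_subgroupOf_eq_of_le hK.1]
      refine Subgroup.map_mono (le_sSup ⟨hK.2.1, ?_⟩)
      rw [Subgroup.map_subgroupOf_eq_of_le hK.1]
      exact hK.2.2
    · rw [Subgroup.map_le_iff_le_comap]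
      refine sSup_le fun L hL => ?_
      rw [← Subgroup.map_le_iff_le_comap]
      refine le_sSup ⟨Subgroup.map_subtype_le L, ?_, hL.2⟩
      rw [Subgroup.subgroupOf, Subgroup.comap_map_eq_self_of_injective H.subtype_injective]
      exact hL.1
  rw [h]
  exact Subgroup.sSup_normal _ fun L hL => hL.1

instance radical_top_normal (𝓕 : Set (Subgroup G)) : (radical 𝓕 (⊤ : Subgroup G)).Normal :=
  Subgroup.sSup_normal _ fun K hK => by
    have := (Subgroup.normal_subgroupOf_iff_le_normalizer hK.1).1 hK.2.1
    exact Subgroup.normalizer_eq_top_iff.1 (top_le_iff.1 this)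

/-- A class of groups. -/
def GroupClass : Type (u + 1) := (K : Type u) → [Group K] → Prop

/-- The class `𝔑` of nilpotent groups. -/
def nilpotentGroups : GroupClass.{u} := fun K _ => Group.IsNilpotent K

/-- The class `𝔖` of soluble groups. -/
def solubleGroups : GroupClass.{u} := fun K _ => Group.IsSolvable K

/-- The product `𝓕 ∘ 𝔉 = {H ≤ G : H / H_𝓕 ∈ 𝔉}`. -/
def product (𝓕 : Set (Subgroup G)) (𝔉 : GroupClass.{u}) : Set (Subgroup G) :=
  {H | 𝔉 (H ⧸ (radical 𝓕 H).subgroupOf H)}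

/-- The trace of `𝔉` in `G`: the set of all subgroups of `G` that belong to `𝔉`. -/
def trace (𝔉 : GroupClass.{u}) (G : Type u) [Group G] : Set (Subgroup G) :=
  {H | 𝔉 H}

/-- `V` is an `𝓕`-maximal subgroup of the subgroup `N` of `G`. -/
def IsMaximalIn (𝓕 : Set (Subgroup G)) (N V : Subgroup G) : Prop :=
  Maximal (fun U => U ≤ N ∧ U ∈ 𝓕) V

/-- `V` is an `𝓕`-injector of `G`: `V ∩ N` is an `𝓕`-maximal subgroup of `N` for every subnormal
subgroup `N` of `G`. -/
def IsInjector (𝓕 : Set (Subgroup G)) (V : Subgroup G) : Prop :=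
  ∀ N : Subgroup G, N.IsSubnormal → IsMaximalIn 𝓕 N (V ⊓ N)

/-- `V` is a nilpotent injector of `G`. -/
def IsNilpotentInjector (V : Subgroup G) : Prop :=
  IsInjector (trace nilpotentGroups G) V

end FittingSets

/-! ### Fitting's theorem relative to a subgroup, and centralizers in soluble groups. -/

namespace Subgroup

variable {G : Type*} [Group G]

/-! Write `K` for the `𝓧`-radical of `G` and `E` for its radical with respect to `𝓗 = 𝓧 ∘ 𝔑`. The
key fact is that every `U ≥ E` has `𝓧`-radical exactly `K` (`radical_le_of_radical_product_le`).
Indeed `U_𝓧 ∩ E` is normal in `E` and lies in `𝓧`, hence in `K`; so `[E, U_𝓧] ≤ K`. Now `E/K` is the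
Fitting subgroup of the soluble group `G/K`, hence contains its centralizer, which gives `U_𝓧 ≤ E`
and then `U_𝓧 ≤ K`. So above `E`, membership in `𝓗` means nilpotency modulo `K`, and `𝓗`-maximal
subgroups above `E` correspond to maximal nilpotent subgroups of `G/K` above its Fitting subgroup.

In a soluble group the latter are precisely the nilpotent injectors (`isNilpotentInjector_iff`). Let
`F` be the Fitting subgroup, `V ≥ F` maximal nilpotent, and `C_p` the centralizer of the `p'`-part
of `F`. A `p`-subgroup of `C_p` and a `q`-subgroup of `C_q`, containing the `p`- and `q`-parts of
`F`, commute; maximality then makes the `p`-part of `V` a Sylow subgroup of `C_p`. Sylow subgroups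
meet subnormal subgroups in Sylow subgroups, which gives the injector property prime by prime.

An `𝓗`-injector clearly contains `E` and is `𝓗`-maximal. Conversely, the key fact applied inside
each subnormal subgroup lifts the injector property from `G/K` to `G` (`isInjector_product_of_map`).
-/

theorem commutator_le_iff_map_mk'_le_centralizer {X S Y : Subgroup G} [Y.Normal] :
    ⁅X, S⁆ ≤ Y ↔
      X.map (QuotientGroup.mk' Y) ≤ centralizer (S.map (QuotientGroup.mk' Y) : Set (G ⧸ Y)) := by
  rw [← commutator_eq_bot_iff_le_centralizer, ← map_commutator, map_eq_bot_iff,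
    QuotientGroup.ker_mk']

theorem iSup_commutator_le {ι : Sort*} {X : ι → Subgroup G} {S Y : Subgroup G} [Y.Normal]
    (h : ∀ i, ⁅X i, S⁆ ≤ Y) : ⁅⨆ i, X i, S⁆ ≤ Y := by
  rw [commutator_le_iff_map_mk'_le_centralizer, map_iSup]
  exact iSup_le fun i => commutator_le_iff_map_mk'_le_centralizer.1 (h i)

theorem commutator_sup_le {X A B Y : Subgroup G} [Y.Normal]
    (hA : ⁅X, A⁆ ≤ Y) (hB : ⁅X, B⁆ ≤ Y) : ⁅X, A ⊔ B⁆ ≤ Y := by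
  rw [commutator_comm] at hA hB ⊢
  rw [commutator_le_iff_map_mk'_le_centralizer] at hA hB ⊢
  rw [map_sup]
  exact sup_le hA hB

/-- The lower central series of a subgroup `A`, preceded by the whole group. -/
def lowerCentralSeriesFromTop (A : Subgroup G) : ℕ → Subgroup G
  | 0 => ⊤
  | k + 1 => A.lowerCentralSeries k

instance lowerCentralSeriesFromTop_normal (A : Subgroup G) [A.Normal] (i : ℕ) :
    (A.lowerCentralSeriesFromTop i).Normal := by
  cases i with
  | zero => exact normal_of_characteristic (⊤ : Subgroup G)
  | succ k => exact lowerCentralSeries_normal A k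

theorem commutator_lowerCentralSeriesFromTop_le (A : Subgroup G) [A.Normal] (i : ℕ) :
    ⁅A.lowerCentralSeriesFromTop i, A⁆ ≤ A.lowerCentralSeriesFromTop (i + 1) := by
  cases i with
  | zero => exact commutator_le_right _ _
  | succ k => exact le_rfl

/-- Commutation with `A` raises `i` by one, commutation with `B` raises `j`, and by normality the
other factor of the intersection is preserved. -/
theorem lowerCentralSeries_sup_le_iSup (A B : Subgroup G) [A.Normal] [B.Normal] (n : ℕ) :
    (A ⊔ B).lowerCentralSeries n ≤
      ⨆ ij : {ij : ℕ × ℕ // ij.1 + ij.2 = n + 1},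
        A.lowerCentralSeriesFromTop ij.1.1 ⊓ B.lowerCentralSeriesFromTop ij.1.2 := by
  have hle : ∀ n i j : ℕ, i + j = n + 1 →
      A.lowerCentralSeriesFromTop i ⊓ B.lowerCentralSeriesFromTop j ≤
        ⨆ ij : {ij : ℕ × ℕ // ij.1 + ij.2 = n + 1},
          A.lowerCentralSeriesFromTop ij.1.1 ⊓ B.lowerCentralSeriesFromTop ij.1.2 :=
    fun n i j h => le_iSup (fun ij : {ij : ℕ × ℕ // ij.1 + ij.2 = n + 1} =>
      A.lowerCentralSeriesFromTop ij.1.1 ⊓ B.lowerCentralSeriesFromTop ij.1.2) ⟨(i, j), h⟩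
  induction n with
  | zero =>
    exact sup_le ((le_inf le_rfl le_top).trans (hle 0 1 0 rfl))
      ((le_inf le_top le_rfl).trans (hle 0 0 1 rfl))
  | succ n ih =>
    rw [lowerCentralSeries_succ]
    refine (commutator_mono ih le_rfl).trans (iSup_commutator_le ?_)
    rintro ⟨⟨i, j⟩, hij⟩
    dsimp only at hij ⊢
    refine commutator_sup_le ((le_inf ?_ ?_).trans (hle (n + 1) (i + 1) j (by omega)))
      ((le_inf ?_ ?_).trans (hle (n + 1) i (j + 1) (by omega)))
    · exact (commutator_mono inf_le_left le_rfl).trans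
        (commutator_lowerCentralSeriesFromTop_le A i)
    · exact (commutator_mono inf_le_right le_rfl).trans (commutator_le_left _ _)
    · exact (commutator_mono inf_le_left le_rfl).trans (commutator_le_left _ _)
    · exact (commutator_mono inf_le_right le_rfl).trans
        (commutator_lowerCentralSeriesFromTop_le B j)

theorem lowerCentralSeries_sup_le {A B R : Subgroup G} [A.Normal] [B.Normal] {a b : ℕ}
    (hA : A.lowerCentralSeries a ≤ R) (hB : B.lowerCentralSeries b ≤ R) :
    (A ⊔ B).lowerCentralSeries (a + b + 1) ≤ R := by
  refine (lowerCentralSeries_sup_le_iSup A B _).trans (iSup_le ?_)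
  rintro ⟨⟨i, j⟩, hij⟩
  dsimp only at hij ⊢
  -- Here `i + j = a + b + 2`, and the shifted series reaches `lowerCentralSeries a` at index `a +
  -- 1`; so one of the two factors is already inside `R`.
  by_cases hi : a + 1 ≤ i
  · obtain ⟨k, rfl⟩ := Nat.exists_eq_add_of_le' (Nat.one_le_of_lt hi)
    exact inf_le_left.trans ((A.lowerCentralSeries_antitone (by omega)).trans hA)
  · obtain ⟨k, rfl⟩ := Nat.exists_eq_add_of_le' (show 1 ≤ j by omega)
    exact inf_le_right.trans ((B.lowerCentralSeries_antitone (by omega)).trans hB)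

theorem lowerCentralSeries_subgroupOf_le_iff {S M R : Subgroup G} (h : S ≤ M) (n : ℕ) :
    (S.subgroupOf M).lowerCentralSeries n ≤ R.subgroupOf M ↔ S.lowerCentralSeries n ≤ R := by
  rw [subgroupOf, subgroupOf, ← map_le_iff_le_comap, map_lowerCentralSeries]
  rw [← subgroupOf, map_subgroupOf_eq_of_le h]

/-- A relative form of Fitting's theorem. -/
theorem lowerCentralSeries_sup_le_of_normal_sup {S T R : Subgroup G}
    (hS : (S.subgroupOf (S ⊔ T)).Normal) (hT : (T.subgroupOf (S ⊔ T)).Normal) {a b : ℕ}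
    (ha : S.lowerCentralSeries a ≤ R) (hb : T.lowerCentralSeries b ≤ R) :
    (S ⊔ T).lowerCentralSeries (a + b + 1) ≤ R := by
  rw [← lowerCentralSeries_subgroupOf_le_iff le_rfl, subgroupOf_sup le_sup_left le_sup_right]
  exact lowerCentralSeries_sup_le
    ((lowerCentralSeries_subgroupOf_le_iff le_sup_left a).2 ha)
    ((lowerCentralSeries_subgroupOf_le_iff le_sup_right b).2 hb)

theorem isNilpotent_sup {S T : Subgroup G}
    (hS : (S.subgroupOf (S ⊔ T)).Normal) (hT : (T.subgroupOf (S ⊔ T)).Normal)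
    (ha : Group.IsNilpotent S) (hb : Group.IsNilpotent T) :
    Group.IsNilpotent (S ⊔ T : Subgroup G) := by
  rw [isNilpotent_iff_lowerCentralSeries] at *
  obtain ⟨a, ha⟩ := ha
  obtain ⟨b, hb⟩ := hb
  exact ⟨_, le_bot_iff.1 (lowerCentralSeries_sup_le_of_normal_sup hS hT ha.le hb.le)⟩

/-- In a soluble group a normal subgroup that contains every normal nilpotent subgroup contains
its own centralizer. -/
theorem centralizer_le_of_isSolvable [Group.IsSolvable G] {F : Subgroup G} [F.Normal]
    (hF : ∀ L : Subgroup G, L.Normal → Group.IsNilpotent L → L ≤ F) :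
    centralizer (F : Set G) ≤ F := by
  obtain ⟨n, hn⟩ := Group.IsSolvable.solvable (G := G)
  have key : ∀ k ≤ n, centralizer (F : Set G) ⊓ derivedSeries G (n - k) ≤ F := by
    intro k
    induction k with
    | zero => intro _; simp [hn]
    | succ k ih =>
      intro hk
      have hD := derivedSeries_normal G (n - (k + 1))
      -- The intersection `X` of the centralizer with this derived term has `[X, X] ≤ F` by `ih`,
      -- and `X` centralizes `F`; so `X` has class at most 2.
      refine hF _ inferInstance ?_
      rw [isNilpotent_iff_lowerCentralSeries]
      refine ⟨2, ?_⟩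
      rw [lowerCentralSeries_succ, commutator_eq_bot_iff_le_centralizer]
      have h1 : (centralizer (F : Set G) ⊓ derivedSeries G (n - (k + 1))).lowerCentralSeries 1
          ≤ F := by
        refine le_trans (le_inf ?_ ?_) (ih (by omega))
        · exact (lowerCentralSeries_le_self _ _).trans inf_le_left
        · rw [show n - k = n - (k + 1) + 1 by omega, derivedSeries_succ]
          exact commutator_mono inf_le_right inf_le_right
      refine h1.trans ?_
      rw [← commutator_eq_bot_iff_le_centralizer, commutator_comm,
        commutator_eq_bot_iff_le_centralizer]
      exact inf_le_left
  simpa using key n le_rfl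

end Subgroup

/-! ### Radicals of Fitting sets, and the Fitting set `𝓧 ∘ 𝔑`. -/

namespace FittingSets

open Subgroup

universe u

variable {G : Type u} [Group G]

theorem le_radical {𝓕 : Set (Subgroup G)} {H K : Subgroup G} (h : K ≤ H)
    (hn : H ≤ normalizer (K : Set G)) (hK : K ∈ 𝓕) : K ≤ radical 𝓕 H :=
  le_sSup ⟨h, (normal_subgroupOf_iff_le_normalizer h).2 hn, hK⟩

theorem le_normalizer_radical (𝓕 : Set (Subgroup G)) (H : Subgroup G) :
    H ≤ normalizer (radical 𝓕 H : Set G) :=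
  (normal_subgroupOf_iff_le_normalizer (radical_le 𝓕 H)).1 inferInstance

theorem IsFittingSet.bot_mem {𝓕 : Set (Subgroup G)} (h : IsFittingSet 𝓕) : ⊥ ∈ 𝓕 := by
  obtain ⟨S, hS⟩ := h.nonempty
  exact h.normal_mem S ⊥ hS bot_le (by rw [bot_subgroupOf]; infer_instance)

theorem IsFittingSet.mem_of_le_normalizer {𝓕 : Set (Subgroup G)} (h : IsFittingSet 𝓕)
    {S T : Subgroup G} (hS : S ∈ 𝓕) (hTS : T ≤ S) (hn : S ≤ normalizer (T : Set G)) : T ∈ 𝓕 :=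
  h.normal_mem S T hS hTS ((normal_subgroupOf_iff_le_normalizer hTS).2 hn)

theorem le_normalizer_sup {A B M : Subgroup G} (hA : M ≤ normalizer (A : Set G))
    (hB : M ≤ normalizer (B : Set G)) : M ≤ normalizer ((A ⊔ B : Subgroup G) : Set G) := by
  have key : ∀ m ∈ M, (A ⊔ B).map (MulAut.conj m).toMonoidHom ≤ A ⊔ B := by
    intro m hm
    rw [Subgroup.map_sup]
    refine sup_le_sup ?_ ?_
    · rintro _ ⟨x, hx, rfl⟩
      exact (le_normalizer_iff.1 hA) m hm x hx
    · rintro _ ⟨x, hx, rfl⟩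
      exact (le_normalizer_iff.1 hB) m hm x hx
  exact le_normalizer_iff.2 fun m hm x hx => key m hm (mem_map_of_mem _ hx)

/-- By finiteness there is a maximal normal `𝓕`-subgroup of `H`; closure under products makes it
absorb all the others. -/
theorem IsFittingSet.radical_mem [Finite G] {𝓕 : Set (Subgroup G)} (h : IsFittingSet 𝓕)
    (H : Subgroup G) : radical 𝓕 H ∈ 𝓕 := by
  set A : Set (Subgroup G) := {K | K ≤ H ∧ (K.subgroupOf H).Normal ∧ K ∈ 𝓕} with hA
  have hne : A.Nonempty := ⟨⊥, bot_le, by rw [bot_subgroupOf]; infer_instance, h.bot_mem⟩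
  obtain ⟨K, hK⟩ := A.toFinite.exists_maximal hne
  have hsup : ∀ L ∈ A, L ≤ K := by
    intro L hL
    have hKn := (normal_subgroupOf_iff_le_normalizer hK.1.1).1 hK.1.2.1
    have hLn := (normal_subgroupOf_iff_le_normalizer hL.1).1 hL.2.1
    have hle : K ⊔ L ≤ H := sup_le hK.1.1 hL.1
    have hmem : K ⊔ L ∈ A := by
      refine ⟨hle, (normal_subgroupOf_iff_le_normalizer hle).2 (le_normalizer_sup hKn hLn), ?_⟩
      exact h.mul_mem K L hK.1.2.2 hL.2.2
        ((normal_subgroupOf_iff_le_normalizer le_sup_left).2 (hle.trans hKn))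
        ((normal_subgroupOf_iff_le_normalizer le_sup_right).2 (hle.trans hLn))
    exact le_sup_right.trans (hK.2 hmem le_sup_left)
  have : radical 𝓕 H = K := le_antisymm (sSup_le hsup) (le_sSup hK.1)
  rw [this]
  exact hK.1.2.2

theorem map_conj_eq {N : Subgroup G} {m : G} (hm : m ∈ normalizer (N : Set G)) :
    N.map (MulAut.conj m).toMonoidHom = N := by
  ext x
  simp only [mem_map, MulEquiv.coe_toMonoidHom, MulAut.conj_apply]
  constructor
  · rintro ⟨y, hy, rfl⟩
    exact (mem_normalizer_iff.1 hm y).1 hy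
  · intro hx
    refine ⟨m⁻¹ * x * m, ?_, by group⟩
    rw [mem_normalizer_iff.1 hm]
    convert hx using 1
    group

theorem IsFittingSet.map_conj_radical [Finite G] {𝓕 : Set (Subgroup G)} (h : IsFittingSet 𝓕)
    (N : Subgroup G) (m : G) :
    (radical 𝓕 N).map (MulAut.conj m).toMonoidHom =
      radical 𝓕 (N.map (MulAut.conj m).toMonoidHom) := by
  have key : ∀ (N : Subgroup G) (m : G), (radical 𝓕 N).map (MulAut.conj m).toMonoidHom ≤
      radical 𝓕 (N.map (MulAut.conj m).toMonoidHom) := fun N m =>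
    le_radical (map_mono (radical_le 𝓕 N))
      ((map_mono (le_normalizer_radical 𝓕 N)).trans (le_normalizer_map _))
      (h.conj_mem _ _ (h.radical_mem N))
  refine le_antisymm (key N m) ?_
  have hinv : ∀ S : Subgroup G, (S.map (MulAut.conj m⁻¹).toMonoidHom).map
      (MulAut.conj m).toMonoidHom = S := by
    intro S
    rw [map_map]
    convert map_id S
    ext x
    simp [mul_assoc]
  have hinv' : ∀ S : Subgroup G, (S.map (MulAut.conj m).toMonoidHom).map
      (MulAut.conj m⁻¹).toMonoidHom = S := by
    intro S
    rw [map_map]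
    convert map_id S
    ext x
    simp [mul_assoc]
  have h2 := map_mono (f := (MulAut.conj m).toMonoidHom)
    (key (N.map (MulAut.conj m).toMonoidHom) m⁻¹)
  rwa [hinv, hinv'] at h2

theorem IsFittingSet.le_normalizer_radical_of_normal [Finite G] {𝓕 : Set (Subgroup G)}
    (h : IsFittingSet 𝓕) {N M : Subgroup G} (hn : M ≤ normalizer (N : Set G)) :
    M ≤ normalizer (radical 𝓕 N : Set G) := by
  refine le_normalizer_iff.2 fun m hm x hx => ?_
  have := mem_map_of_mem (MulAut.conj m).toMonoidHom hx
  rwa [h.map_conj_radical, map_conj_eq (hn hm)] at this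

/-- Conjugation by `M` fixes `N`, hence its radical, which is therefore normal in `M`; conversely
the intersection is normal in the radical of `M`, so lies in `𝓕`. -/
theorem IsFittingSet.radical_eq_inf_of_normal [Finite G] {𝓕 : Set (Subgroup G)}
    (h : IsFittingSet 𝓕) {N M : Subgroup G} (hNM : N ≤ M) (hn : M ≤ normalizer (N : Set G)) :
    radical 𝓕 N = radical 𝓕 M ⊓ N := by
  refine le_antisymm (le_inf ?_ (radical_le 𝓕 N)) ?_
  · exact le_radical ((radical_le 𝓕 N).trans hNM) (h.le_normalizer_radical_of_normal hn)
      (h.radical_mem N)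
  · have hM : M ≤ normalizer ((radical 𝓕 M ⊓ N : Subgroup G) : Set G) :=
      (le_inf (le_normalizer_radical 𝓕 M) hn).trans (by exact inf_normalizer_le_normalizer_inf)
    exact le_radical inf_le_right (hNM.trans hM)
      (h.mem_of_le_normalizer (h.radical_mem M) inf_le_left ((radical_le 𝓕 M).trans hM))

theorem IsFittingSet.radical_eq_inf_of_isSubnormal [Finite G] {𝓕 : Set (Subgroup G)}
    (h : IsFittingSet 𝓕) {N : Subgroup G} (hN : N.IsSubnormal) :
    radical 𝓕 N = radical 𝓕 ⊤ ⊓ N := by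
  induction hN with
  | top => simp
  | step H K hle _ hn ih =>
    rw [h.radical_eq_inf_of_normal hle ((normal_subgroupOf_iff_le_normalizer hle).1 hn), ih,
      inf_assoc, inf_eq_right.2 hle]

theorem mem_product_nilpotentGroups_iff {𝓕 : Set (Subgroup G)} {H : Subgroup G} :
    H ∈ product 𝓕 nilpotentGroups ↔ ∃ n, H.lowerCentralSeries n ≤ radical 𝓕 H := by
  change Group.IsNilpotent (H ⧸ (radical 𝓕 H).subgroupOf H) ↔ _
  rw [Subgroup.nilpotent_iff_lowerCentralSeries]
  refine exists_congr fun n => ?_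
  rw [← map_top_of_surjective _ (QuotientGroup.mk'_surjective ((radical 𝓕 H).subgroupOf H)),
    ← map_lowerCentralSeries, Subgroup.map_eq_bot_iff, QuotientGroup.ker_mk', subgroupOf,
    ← map_le_iff_le_comap, top_subtype_lowerCentralSeries]

/-- Radicals of normal subgroups are intersections, so the lower central series of `S` and `T` both
fall into the `𝓧`-radical of `ST`, where the relative Fitting theorem applies. -/
theorem isFittingSet_product_nilpotentGroups [Finite G] {𝓧 : Set (Subgroup G)}
    (h : IsFittingSet 𝓧) : IsFittingSet (product 𝓧 nilpotentGroups) where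
  nonempty := ⟨⊥, mem_product_nilpotentGroups_iff.2 ⟨0, bot_le⟩⟩
  normal_mem S T hS hTS hn := by
    rw [mem_product_nilpotentGroups_iff] at hS ⊢
    obtain ⟨n, hn'⟩ := hS
    refine ⟨n, ?_⟩
    rw [h.radical_eq_inf_of_normal hTS ((normal_subgroupOf_iff_le_normalizer hTS).1 hn)]
    exact le_inf ((lowerCentralSeries_mono n hTS).trans hn') (lowerCentralSeries_le_self T n)
  mul_mem S T hS hT hSn hTn := by
    rw [mem_product_nilpotentGroups_iff] at hS hT ⊢
    obtain ⟨a, ha⟩ := hS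
    obtain ⟨b, hb⟩ := hT
    rw [h.radical_eq_inf_of_normal le_sup_left
      ((normal_subgroupOf_iff_le_normalizer le_sup_left).1 hSn)] at ha
    rw [h.radical_eq_inf_of_normal le_sup_right
      ((normal_subgroupOf_iff_le_normalizer le_sup_right).1 hTn)] at hb
    exact ⟨_, lowerCentralSeries_sup_le_of_normal_sup hSn hTn (ha.trans inf_le_left)
      (hb.trans inf_le_left)⟩
  conj_mem S x hS := by
    rw [mem_product_nilpotentGroups_iff] at hS ⊢
    obtain ⟨n, hn⟩ := hS
    refine ⟨n, ?_⟩
    rw [← map_lowerCentralSeries, ← h.map_conj_radical]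
    exact map_mono hn

theorem isFittingSet_trace_nilpotentGroups (G : Type u) [Group G] :
    IsFittingSet (trace nilpotentGroups G) where
  nonempty := ⟨⊥, show Group.IsNilpotent (⊥ : Subgroup G) from inferInstance⟩
  normal_mem S T hS hTS _ := by
    have : Group.IsNilpotent S := hS
    exact Group.nilpotent_of_mulEquiv (subgroupOfEquivOfLe hTS)
  mul_mem S T hS hT hSn hTn := isNilpotent_sup hSn hTn hS hT
  conj_mem S x hS := by
    have : Group.IsNilpotent S := hS
    exact Group.nilpotent_of_mulEquiv (S.equivMapOfInjective _ (MulAut.conj x).injective)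

end FittingSets

/-! ### Elements of prime power order in finite and in nilpotent groups. -/

namespace FittingSets

open Subgroup
open scoped commutatorElement

section PrimePowerOrder

variable {G : Type*} [Group G]

/-- A subgroup containing every power of `x` of prime power order contains `x`. -/
theorem mem_of_forall_prime_pow [Finite G] {S : Subgroup G} {x : G}
    (h : ∀ y ∈ zpowers x, ∀ p k : ℕ, p.Prime → y ^ p ^ k = 1 → y ∈ S) : x ∈ S := by
  have key : ∀ n : ℕ, n ≠ 0 → ∀ y ∈ zpowers x, y ^ n = 1 → y ∈ S := by
    intro n
    induction n using Nat.recOnPosPrimePosCoprime with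
    | prime_pow p k hp _ => exact fun _ y hy hyn => h y hy p k hp hyn
    | zero => exact fun h0 => absurd rfl h0
    | one => intro _ y _ hy1; rw [pow_one] at hy1; exact hy1 ▸ S.one_mem
    | coprime a b ha hb hab iha ihb =>
      intro _ y hy hyn
      have hya : y ^ a ∈ S := ihb (by omega) _ (pow_mem hy _) (by rwa [← pow_mul])
      have hyb : y ^ b ∈ S := iha (by omega) _ (pow_mem hy _) (by rwa [← pow_mul, mul_comm])
      have hb := Nat.gcd_eq_gcd_ab a b
      rw [Nat.Coprime.gcd_eq_one hab] at hb
      have : y = (y ^ a) ^ (Nat.gcdA a b) * (y ^ b) ^ (Nat.gcdB a b) := by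
        rw [← zpow_natCast, ← zpow_natCast, ← zpow_mul, ← zpow_mul, ← zpow_add, ← hb]
        simp
      rw [this]
      exact mul_mem (zpow_mem hya _) (zpow_mem hyb _)
  exact key (orderOf x) (orderOf_pos x).ne' x (mem_zpowers x) (pow_orderOf_eq_one x)

/-- The decomposition of an element into a part of `p`-power order and a part of order prime to `p`. -/
theorem exists_eq_mul_of_prime [Finite G] {p : ℕ} (hp : p.Prime) (z : G) :
    ∃ a ∈ zpowers z, ∃ b ∈ zpowers z, z = a * b ∧ (∃ k, a ^ p ^ k = 1) ∧
      (orderOf b).Coprime p := by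
  obtain ⟨k, m, hm, hz⟩ := Nat.exists_eq_pow_mul_and_not_dvd (orderOf_pos z).ne' p hp.ne_one
  have hcop : (p ^ k).Coprime m := Nat.Coprime.pow_left _ ((Nat.Prime.coprime_iff_not_dvd hp).2 hm)
  have hb := Nat.gcd_eq_gcd_ab (p ^ k) m
  rw [hcop.gcd_eq_one] at hb
  have hz1 : z ^ (p ^ k * m) = 1 := hz ▸ pow_orderOf_eq_one z
  refine ⟨(z ^ m) ^ (Nat.gcdB (p ^ k) m), zpow_mem (pow_mem (mem_zpowers z) _) _,
    (z ^ p ^ k) ^ (Nat.gcdA (p ^ k) m), zpow_mem (pow_mem (mem_zpowers z) _) _, ?_, ⟨k, ?_⟩, ?_⟩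
  · rw [← zpow_natCast, ← zpow_natCast, ← zpow_mul, ← zpow_mul, ← zpow_add, add_comm, ← hb]
    simp
  · rw [← zpow_natCast, zpow_comm, zpow_natCast, ← pow_mul, mul_comm, hz1, one_zpow]
  · have hd : orderOf ((z ^ p ^ k) ^ (Nat.gcdA (p ^ k) m)) ∣ m := by
      apply orderOf_dvd_of_pow_eq_one
      rw [← zpow_natCast, zpow_comm, zpow_natCast, ← pow_mul, hz1, one_zpow]
    exact Nat.Coprime.coprime_dvd_left hd ((Nat.Prime.coprime_iff_not_dvd hp).2 hm).symm

theorem eq_one_of_prime_pow_of_coprime {p k : ℕ} {b : G} (hb : b ^ p ^ k = 1)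
    (h : (orderOf b).Coprime p) : b = 1 := by
  rw [← orderOf_eq_one_iff]
  exact Nat.Coprime.eq_one_of_dvd (h.pow_right k) (orderOf_dvd_of_pow_eq_one hb)

theorem eq_one_of_prime_pow_of_prime_pow {p q k l : ℕ} (hp : p.Prime) (hq : q.Prime) (hpq : p ≠ q)
    {b : G} (hb : b ^ p ^ k = 1) (hb' : b ^ q ^ l = 1) : b = 1 := by
  refine eq_one_of_prime_pow_of_coprime hb ?_
  exact Nat.Coprime.coprime_dvd_left (orderOf_dvd_of_pow_eq_one hb')
    (Nat.Coprime.pow_left _ ((Nat.coprime_primes hq hp).2 hpq.symm))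

theorem exists_pow_eq_one_of_isPGroup {p : ℕ} {P : Subgroup G} (hP : IsPGroup p P) {x : G}
    (hx : x ∈ P) : ∃ k, x ^ p ^ k = 1 := by
  obtain ⟨k, hk⟩ := isPGroup_iff_pow_pow_eq_one.1 hP ⟨x, hx⟩
  exact ⟨k, by simpa using congrArg Subtype.val hk⟩

/-- The elements of `p`-power order of a finite nilpotent subgroup form a `p`-subgroup. -/
theorem exists_isPGroup_of_isNilpotent [Finite G] {U : Subgroup G} (hU : Group.IsNilpotent U)
    {p : ℕ} (hp : p.Prime) :
    ∃ P ≤ U, IsPGroup p P ∧ ∀ x ∈ U, ∀ k, x ^ p ^ k = 1 → x ∈ P := by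
  have := Fact.mk hp
  obtain ⟨P⟩ : Nonempty (Sylow p U) := inferInstance
  refine ⟨(P : Subgroup U).map U.subtype, map_subtype_le _, P.isPGroup'.map _, ?_⟩
  intro x hx k hk
  have hxP : IsPGroup p (zpowers (⟨x, hx⟩ : U)) := by
    refine IsPGroup.of_card_dvd_pow (n := k) ?_
    rw [Nat.card_zpowers]
    exact orderOf_dvd_of_pow_eq_one (Subtype.ext (by simpa using hk))
  obtain ⟨Q, hQ⟩ := hxP.exists_le_sylow
  have hPQ : Q = P := by
    have := Sylow.unique_of_normal P inferInstance
    exact Subsingleton.elim _ _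
  exact ⟨⟨x, hx⟩, hPQ ▸ hQ (mem_zpowers _), rfl⟩

theorem commute_of_isNilpotent [Finite G] {U : Subgroup G} (hU : Group.IsNilpotent U) {p q : ℕ}
    (hp : p.Prime) (hq : q.Prime) (hpq : p ≠ q) {x y : G} (hx : x ∈ U) (hy : y ∈ U) {k l : ℕ}
    (hxk : x ^ p ^ k = 1) (hyl : y ^ q ^ l = 1) : Commute x y := by
  obtain ⟨P, hPU, hP, hPmem⟩ := exists_isPGroup_of_isNilpotent hU hp
  obtain ⟨R, hRU, hR, hRmem⟩ := exists_isPGroup_of_isNilpotent hU hq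
  rw [← commutatorElement_eq_one_iff_commute]
  have hzP : ⁅x, y⁆ ∈ P := by
    rw [commutatorElement_def, mul_assoc, mul_assoc]
    refine mul_mem (hPmem x hx k hxk) (hPmem _ ?_ k ?_)
    · exact mul_mem hy (mul_mem (inv_mem hx) (inv_mem hy))
    · rw [← mul_assoc, conj_pow, inv_pow, hxk]
      simp
  have hzR : ⁅x, y⁆ ∈ R := by
    rw [commutatorElement_def]
    refine mul_mem (hRmem _ ?_ l ?_) (inv_mem (hRmem y hy l hyl))
    · exact mul_mem (mul_mem hx hy) (inv_mem hx)
    · rw [conj_pow, hyl]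
      simp
  obtain ⟨m, hm⟩ := exists_pow_eq_one_of_isPGroup hP hzP
  obtain ⟨n, hn⟩ := exists_pow_eq_one_of_isPGroup hR hzR
  exact eq_one_of_prime_pow_of_prime_pow hp hq hpq hm hn

end PrimePowerOrder

/-! ### Sylow subgroups and subnormal subgroups. -/

section Sylow

variable {G : Type*} [Group G]

theorem relIndex_dvd_index_of_normal_right [Finite G] (P A : Subgroup G) [A.Normal] :
    P.relIndex A ∣ P.index := by
  have h1 := relIndex_mul_relIndex (P ⊓ A) P (P ⊔ A) inf_le_left le_sup_left
  have h2 := relIndex_mul_relIndex (P ⊓ A) A (P ⊔ A) inf_le_right le_sup_right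
  rw [← h2, inf_relIndex_left, inf_relIndex_right, relIndex_sup_right, mul_comm] at h1
  have h3 : A.relIndex P ≠ 0 := index_ne_zero_of_finite
  rw [← Nat.eq_of_mul_eq_mul_right (Nat.pos_of_ne_zero h3) h1]
  exact relIndex_dvd_index_of_le le_sup_left

theorem not_dvd_relIndex_of_isSubnormal [Finite G] {p : ℕ} [Fact p.Prime] (P : Sylow p G)
    {N : Subgroup G} (hN : N.IsSubnormal) : ¬ p ∣ (P : Subgroup G).relIndex N := by
  induction hN with
  | top => rw [relIndex_top_right]; exact P.not_dvd_index
  | step H K hle _ hn ih =>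
    intro hdvd
    refine ih (hdvd.trans ?_)
    rw [← relIndex_subgroupOf hle]
    exact relIndex_dvd_index_of_normal_right _ _

/-- Since `P ∩ A = P ∩ N`, the index of `P ∩ A` in `A` is a power of `p` dividing the index of `P ∩
N` in `N`, which is prime to `p`. -/
theorem le_sylow_of_isSubnormal [Finite G] {p : ℕ} [Fact p.Prime] (P : Sylow p G)
    {N A : Subgroup G} (hN : N.IsSubnormal) (hAN : A ≤ N) (hA : IsPGroup p A)
    (hPA : (P : Subgroup G) ⊓ N ≤ A) : A ≤ P := by
  have hPA' : (P : Subgroup G) ⊓ A = (P : Subgroup G) ⊓ N :=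
    le_antisymm (inf_le_inf_left _ hAN) (le_inf inf_le_left hPA)
  have h1 : (P : Subgroup G).relIndex A ∣ (P : Subgroup G).relIndex N := by
    have := relIndex_inf_mul_relIndex (P : Subgroup G) A N
    rw [inf_eq_left.2 hAN, hPA', inf_relIndex_right] at this
    exact Dvd.intro _ this
  obtain ⟨n, hn⟩ := hA.index ((P : Subgroup G).subgroupOf A)
  rw [← relIndex_eq_one]
  change (P : Subgroup G).relIndex A = _ at hn
  rw [hn] at h1 ⊢
  cases n with
  | zero => simp
  | succ n =>
    exact absurd ((dvd_pow_self p n.succ_ne_zero).trans h1) (not_dvd_relIndex_of_isSubnormal P hN)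

end Sylow

/-! ### Nilpotent injectors of finite soluble groups. -/

section PrimeToCentralizer

variable {G : Type*} [Group G]

/-- The centralizer of all elements of `F` whose order is a power of a prime other than `p`. -/
def primeToCentralizer (F : Subgroup G) (p : ℕ) : Subgroup G :=
  centralizer {f | f ∈ F ∧ ∃ q k : ℕ, q.Prime ∧ q ≠ p ∧ f ^ q ^ k = 1}

theorem mem_primeToCentralizer_iff {F : Subgroup G} {p : ℕ} {x : G} :
    x ∈ primeToCentralizer F p ↔
      ∀ f ∈ F, ∀ q k : ℕ, q.Prime → q ≠ p → f ^ q ^ k = 1 → Commute f x := by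
  rw [primeToCentralizer, mem_centralizer_iff]
  constructor
  · intro h f hf q k hq hqp hfk
    exact h f ⟨hf, q, k, hq, hqp, hfk⟩
  · rintro h f ⟨hf, q, k, hq, hqp, hfk⟩
    exact h f hf q k hq hqp hfk

instance primeToCentralizer_normal (F : Subgroup G) [hF : F.Normal] (p : ℕ) :
    (primeToCentralizer F p).Normal where
  conj_mem x hx g := by
    rw [mem_primeToCentralizer_iff] at hx ⊢
    intro f hf q k hq hqp hfk
    have h := hx (g⁻¹ * f * g) (by simpa using hF.conj_mem f hf g⁻¹) q k hq hqp (by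
      have := conj_pow (i := q ^ k) (a := g⁻¹) (b := f)
      rw [inv_inv, hfk] at this
      simpa using this)
    have h2 := (Commute.conj_iff g).2 h
    convert h2 using 1
    group

theorem commute_of_mem_primeToCentralizer [Finite G] {F : Subgroup G} {p : ℕ}
    {x f : G} (hx : x ∈ primeToCentralizer F p) (hf : f ∈ F) (hfp : (orderOf f).Coprime p) :
    Commute f x := by
  have : f ∈ centralizer {x} := by
    refine mem_of_forall_prime_pow fun y hy q k hq hyk => ?_
    rw [mem_centralizer_singleton_iff]
    by_cases hqp : q = p
    · subst hqp
      have : y = 1 := eq_one_of_prime_pow_of_coprime hyk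
        (Nat.Coprime.coprime_dvd_left (orderOf_dvd_of_mem_zpowers hy) hfp)
      simp [this]
    · exact (mem_primeToCentralizer_iff.1 hx y (zpowers_le.2 hf hy) q k hq hqp hyk)
  rw [mem_centralizer_singleton_iff] at this
  exact this

/-- The commutator lies in both normal centralizers, and any prime differs from `p` or from `q`, so
it commutes with all prime-power parts of elements of `F`. -/
theorem commutatorElement_mem_centralizer [Finite G] {F : Subgroup G} [F.Normal] {p q : ℕ}
    (hpq : p ≠ q) {x y : G} (hx : x ∈ primeToCentralizer F p) (hy : y ∈ primeToCentralizer F q) :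
    ⁅x, y⁆ ∈ centralizer (F : Set G) := by
  have hz : ⁅x, y⁆ ∈ primeToCentralizer F p ⊓ primeToCentralizer F q :=
    commutator_le_inf _ _ (commutator_mem_commutator hx hy)
  rw [mem_centralizer_iff]
  intro f hf
  have : f ∈ centralizer {⁅x, y⁆} := by
    refine mem_of_forall_prime_pow fun g hg r k hr hgk => ?_
    rw [mem_centralizer_singleton_iff]
    have hgF := zpowers_le.2 hf hg
    by_cases hrp : r = p
    · exact mem_primeToCentralizer_iff.1 hz.2 g hgF r k hr (hrp ▸ hpq) hgk
    · exact mem_primeToCentralizer_iff.1 hz.1 g hgF r k hr hrp hgk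
  rwa [mem_centralizer_singleton_iff] at this

/-- Split `⁅x, y⁆ = a * b` into `p`-part and `p'`-part. Then `x⁻¹ * a ∈ P` commutes with `b`, while
`x⁻¹ * a * b` is a conjugate of `x⁻¹`, a `p`-element; this forces `b = 1`. -/
theorem exists_commutatorElement_pow_eq_one [Finite G] {F P : Subgroup G} {p : ℕ} (hp : p.Prime)
    (hP : IsPGroup p P) (hPC : P ≤ primeToCentralizer F p)
    (hFP : ∀ f ∈ F, ∀ k, f ^ p ^ k = 1 → f ∈ P) {x y : G} (hx : x ∈ P) (hz : ⁅x, y⁆ ∈ F) :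
    ∃ k, ⁅x, y⁆ ^ p ^ k = 1 := by
  obtain ⟨a, ha, b, hb, hab, ⟨k, hk⟩, hbp⟩ := exists_eq_mul_of_prime hp ⁅x, y⁆
  have haP : a ∈ P := hFP a (zpowers_le.2 hz ha) k hk
  have hxa : x⁻¹ * a ∈ P := mul_mem (inv_mem hx) haP
  have hcomm : Commute b (x⁻¹ * a) :=
    commute_of_mem_primeToCentralizer (hPC hxa) (zpowers_le.2 hz hb) hbp
  obtain ⟨m, hm⟩ := exists_pow_eq_one_of_isPGroup hP hxa
  obtain ⟨n, hn⟩ := exists_pow_eq_one_of_isPGroup hP hx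
  have hw : (x⁻¹ * a) * b = y * x⁻¹ * y⁻¹ := by
    rw [mul_assoc, ← hab, commutatorElement_def]
    group
  have hb1 : b ^ p ^ (m + n) = 1 := by
    have h1 : ((x⁻¹ * a) * b) ^ p ^ (m + n) = 1 := by
      rw [hw, conj_pow, inv_pow, pow_add, mul_comm, pow_mul x, hn]
      simp
    rw [hcomm.symm.mul_pow, pow_add, pow_mul (x⁻¹ * a), hm, one_pow, one_mul] at h1
    rwa [pow_add]
  have : b = 1 := eq_one_of_prime_pow_of_coprime hb1 hbp
  exact ⟨k, by rw [hab, this, mul_one, hk]⟩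

/-- If `F` is normal and contains its centralizer, then suitable `p`- and `q`-subgroups, each
centralizing the part of `F` prime to `p` and to `q` respectively, commute elementwise. -/
theorem commute_of_isPGroup_of_isPGroup [Finite G] {F P R : Subgroup G} [F.Normal]
    (hF : centralizer (F : Set G) ≤ F) {p q : ℕ} (hp : p.Prime) (hq : q.Prime) (hpq : p ≠ q)
    (hP : IsPGroup p P) (hPC : P ≤ primeToCentralizer F p)
    (hFP : ∀ f ∈ F, ∀ k, f ^ p ^ k = 1 → f ∈ P)
    (hR : IsPGroup q R) (hRC : R ≤ primeToCentralizer F q)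
    (hFR : ∀ f ∈ F, ∀ k, f ^ q ^ k = 1 → f ∈ R) {x y : G} (hx : x ∈ P) (hy : y ∈ R) :
    Commute x y := by
  have hz : ⁅x, y⁆ ∈ F := hF (commutatorElement_mem_centralizer hpq (hPC hx) (hRC hy))
  have hz' : ⁅y, x⁆ ∈ F := by rw [← commutatorElement_inv]; exact inv_mem hz
  obtain ⟨k, hk⟩ := exists_commutatorElement_pow_eq_one hp hP hPC hFP hx hz
  obtain ⟨l, hl⟩ := exists_commutatorElement_pow_eq_one hq hR hRC hFR hy hz'
  rw [← commutatorElement_inv, inv_pow, inv_eq_one] at hl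
  rw [← commutatorElement_eq_one_iff_commute]
  exact eq_one_of_prime_pow_of_prime_pow hp hq hpq hk hl

theorem mem_primeToCentralizer_of_isNilpotent [Finite G] {F V : Subgroup G}
    (hV : Group.IsNilpotent V) (hFV : F ≤ V) {p k : ℕ} (hp : p.Prime) {x : G} (hx : x ∈ V)
    (hxk : x ^ p ^ k = 1) : x ∈ primeToCentralizer F p :=
  mem_primeToCentralizer_iff.2 fun _ hf _ _ hq hqp hfl =>
    commute_of_isNilpotent hV hq hp hqp (hFV hf) hx hfl hxk

/-- A `p`-element of a subnormal subgroup `N` centralizing the part of `F ∩ N` prime to `p`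
centralizes the part of `F` prime to `p`. -/
theorem mem_primeToCentralizer_of_isSubnormal [Finite G] {F : Subgroup G} [hFn : F.Normal]
    (hF : Group.IsNilpotent F) {N : Subgroup G} (hN : N.IsSubnormal) {p k : ℕ} (hp : p.Prime)
    {a : G} (ha : a ∈ N) (hak : a ^ p ^ k = 1) (h : a ∈ primeToCentralizer (F ⊓ N) p) :
    a ∈ primeToCentralizer F p := by
  induction hN with
  | top => simpa using h
  | step H K hle _ hn ih =>
    refine ih (hle ha) (mem_primeToCentralizer_iff.2 ?_)
    rintro f ⟨hfF, hfK⟩ q l hq hqp hfl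
    obtain ⟨Q, hQF, hQ, hQmem⟩ := exists_isPGroup_of_isNilpotent hF hq
    have hn' := (normal_subgroupOf_iff_le_normalizer hle).1 hn
    have hcQ : ⁅a, f⁆ ∈ Q := by
      rw [commutatorElement_def]
      refine mul_mem (hQmem _ (hFn.conj_mem f hfF a) l ?_) (inv_mem (hQmem f hfF l hfl))
      rw [conj_pow, hfl]
      simp
    have hcH : ⁅a, f⁆ ∈ H := by
      rw [commutatorElement_def, mul_assoc, mul_assoc]
      refine mul_mem ha ?_
      rw [← mul_assoc]
      exact le_normalizer_iff.1 hn' f hfK _ (inv_mem ha)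
    obtain ⟨m, hm⟩ := exists_pow_eq_one_of_isPGroup hQ hcQ
    have hca : Commute ⁅a, f⁆ a :=
      mem_primeToCentralizer_iff.1 h _ ⟨hQF hcQ, hcH⟩ q m hq hqp hm
    -- Coprime action: `⁅a, f⁆` commutes with `a`, so taking `j = p ^ k` shows that this `q`-element
    -- has `p`-power order.
    have hiter : ∀ j : ℕ, a ^ j * f * (a ^ j)⁻¹ = ⁅a, f⁆ ^ j * f := by
      intro j
      induction j with
      | zero => simp
      | succ j ihj =>
        calc a ^ (j + 1) * f * (a ^ (j + 1))⁻¹ = a * (a ^ j * f * (a ^ j)⁻¹) * a⁻¹ := by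
              rw [pow_succ' a j]; group
          _ = a * ⁅a, f⁆ ^ j * f * a⁻¹ := by rw [ihj]; simp only [mul_assoc]
          _ = ⁅a, f⁆ ^ j * (a * f * a⁻¹) := by
              rw [← (hca.pow_left j).eq]; group
          _ = ⁅a, f⁆ ^ (j + 1) * f := by
              rw [pow_succ, mul_assoc, commutatorElement_def]; group
    have hc1 : ⁅a, f⁆ ^ p ^ k = 1 := by
      have := hiter (p ^ k)
      rw [hak] at this
      simpa using this
    have := eq_one_of_prime_pow_of_prime_pow hp hq hqp.symm hc1 hm
    exact (commutatorElement_eq_one_iff_commute.1 this).symm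

/-- The Sylow `p`-subgroup of a maximal nilpotent subgroup containing `F` is a maximal
`p`-subgroup of `primeToCentralizer F p`. -/
theorem le_of_isPGroup_of_maximal [Finite G] {F V P : Subgroup G} [F.Normal]
    (hF : centralizer (F : Set G) ≤ F) (hV : Maximal (fun U : Subgroup G => Group.IsNilpotent U) V)
    (hFV : F ≤ V) {p : ℕ} (hp : p.Prime) (hP : IsPGroup p P) (hPC : P ≤ primeToCentralizer F p)
    (hVP : ∀ v ∈ V, ∀ k, v ^ p ^ k = 1 → v ∈ P) : P ≤ V := by
  have := Fact.mk hp
  set T : Subgroup G := closure {v | v ∈ V ∧ ∃ q k : ℕ, q.Prime ∧ q ≠ p ∧ v ^ q ^ k = 1} with hT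
  have hTV : T ≤ V := (closure_le V).2 fun v hv => hv.1
  have hTP : T ≤ centralizer (P : Set G) := by
    rw [hT, closure_le]
    rintro v ⟨hv, q, k, hq, hqp, hvk⟩
    obtain ⟨R, hRV, hR, hRmem⟩ := exists_isPGroup_of_isNilpotent hV.1 hq
    rw [SetLike.mem_coe, mem_centralizer_iff]
    intro x hx
    refine commute_of_isPGroup_of_isPGroup hF hp hq hqp.symm hP hPC
      (fun f hf => hVP f (hFV hf)) hR ?_ (fun f hf => hRmem f (hFV hf)) hx (hRmem v hv k hvk)
    intro r hr
    obtain ⟨l, hl⟩ := exists_pow_eq_one_of_isPGroup hR hr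
    exact mem_primeToCentralizer_of_isNilpotent hV.1 hFV hq (hRV hr) hl
  have hPT : P ≤ centralizer (T : Set G) := le_centralizer_iff.1 hTP
  have hcn : ∀ S : Subgroup G, centralizer (S : Set G) ≤ normalizer (S : Set G) := fun S =>
    centralizer_le_normalizer _
  -- `T` is the `p'`-part of `V`, so `P ⊔ T` contains `V`, and maximality applies once it is
  -- nilpotent.
  have hnil : Group.IsNilpotent (P ⊔ T : Subgroup G) := by
    refine isNilpotent_sup ?_ ?_ hP.isNilpotent ?_
    · rw [normal_subgroupOf_iff_le_normalizer le_sup_left]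
      exact sup_le le_normalizer (hTP.trans (hcn P))
    · rw [normal_subgroupOf_iff_le_normalizer le_sup_right]
      exact sup_le (hPT.trans (hcn T)) le_normalizer
    · have := hV.1
      exact Group.nilpotent_of_mulEquiv (subgroupOfEquivOfLe hTV)
  have hVle : V ≤ P ⊔ T := by
    intro v hv
    refine mem_of_forall_prime_pow fun y hy q k hq hyk => ?_
    have hyV := zpowers_le.2 hv hy
    by_cases hqp : q = p
    · subst hqp
      exact mem_sup_left (hVP y hyV k hyk)
    · exact mem_sup_right (subset_closure ⟨hyV, q, k, hq, hqp, hyk⟩)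
  exact le_sup_left.trans (hV.2 hnil hVle)

/-- A maximal nilpotent subgroup containing a normal nilpotent subgroup `F ≥ C(F)` intersects
every subnormal subgroup in a maximal nilpotent subgroup. -/
theorem le_of_isNilpotent_of_isSubnormal [Finite G] {F V U N : Subgroup G} [F.Normal]
    (hFnil : Group.IsNilpotent F) (hF : centralizer (F : Set G) ≤ F)
    (hV : Maximal (fun U : Subgroup G => Group.IsNilpotent U) V) (hFV : F ≤ V)
    (hN : N.IsSubnormal) (hUN : U ≤ N) (hU : Group.IsNilpotent U) (hVU : V ⊓ N ≤ U) : U ≤ V := by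
  intro u hu
  refine mem_of_forall_prime_pow fun y hy p k hp hyk => ?_
  have := Fact.mk hp
  obtain ⟨A, hAU, hA, hAmem⟩ := exists_isPGroup_of_isNilpotent hU hp
  obtain ⟨B, hBV, hB, hBmem⟩ := exists_isPGroup_of_isNilpotent hV.1 hp
  have hAC : A ≤ primeToCentralizer F p := by
    intro a ha
    obtain ⟨l, hl⟩ := exists_pow_eq_one_of_isPGroup hA ha
    exact mem_primeToCentralizer_of_isSubnormal hFnil hN hp (hUN (hAU ha)) hl
      (mem_primeToCentralizer_of_isNilpotent hU ((inf_le_inf_right N hFV).trans hVU) hp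
        (hAU ha) hl)
  have hBC : B ≤ primeToCentralizer F p := by
    intro b hb
    obtain ⟨l, hl⟩ := exists_pow_eq_one_of_isPGroup hB hb
    exact mem_primeToCentralizer_of_isNilpotent hV.1 hFV hp (hBV hb) hl
  obtain ⟨P, hP⟩ := (hB.comap_subtype (K := primeToCentralizer F p)).exists_le_sylow
  have hPV : (P : Subgroup (primeToCentralizer F p)).map (primeToCentralizer F p).subtype ≤ V := by
    refine le_of_isPGroup_of_maximal hF hV hFV hp (P.isPGroup'.map _) (map_subtype_le _) ?_
    intro v hv l hl
    have hvB := hBmem v hv l hl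
    exact ⟨⟨v, hBC hvB⟩, hP hvB, rfl⟩
  -- `P ≤ V` gives `P ∩ N ≤ V ∩ N ≤ U`, so the `p`-part `A` of `U` contains `P ∩ N`, a Sylow
  -- subgroup of the subnormal trace of `N`.
  have hAP : A.subgroupOf (primeToCentralizer F p) ≤ P := by
    refine le_sylow_of_isSubnormal P (hN.subgroupOf (K := primeToCentralizer F p))
      (comap_mono (hAU.trans hUN)) hA.comap_subtype ?_
    rintro x ⟨hxP, hxN⟩
    obtain ⟨l, hl⟩ := exists_pow_eq_one_of_isPGroup P.isPGroup' hxP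
    exact hAmem _ (hVU ⟨hPV (mem_map_of_mem _ hxP), hxN⟩) l (by simpa using congrArg Subtype.val hl)
  have hyA := hAmem y (zpowers_le.2 hu hy) k hyk
  exact hPV ⟨⟨y, hAC hyA⟩, hAP hyA, rfl⟩

end PrimeToCentralizer

universe u

variable {G : Type u} [Group G]

theorem isMaximalIn_top_iff {𝓕 : Set (Subgroup G)} {V : Subgroup G} :
    IsMaximalIn 𝓕 ⊤ V ↔ Maximal (· ∈ 𝓕) V := by
  simp [IsMaximalIn]

theorem IsInjector.radical_le_and_isMaximalIn [Finite G] {𝓕 : Set (Subgroup G)}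
    (h : IsFittingSet 𝓕) {V : Subgroup G} (hV : IsInjector 𝓕 V) :
    radical 𝓕 ⊤ ≤ V ∧ IsMaximalIn 𝓕 ⊤ V := by
  constructor
  · have := hV (radical 𝓕 ⊤) (Normal.isSubnormal inferInstance)
    exact (this.2 ⟨le_rfl, h.radical_mem ⊤⟩ inf_le_right).trans inf_le_left
  · simpa using hV ⊤ IsSubnormal.top

/-- The nilpotent injectors of a finite soluble group are the maximal nilpotent subgroups
containing the Fitting subgroup. -/
theorem isNilpotentInjector_iff [Finite G] [Group.IsSolvable G] {V : Subgroup G} :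
    IsNilpotentInjector V ↔ radical (trace nilpotentGroups G) ⊤ ≤ V ∧
      IsMaximalIn (trace nilpotentGroups G) ⊤ V := by
  have hT := isFittingSet_trace_nilpotentGroups G
  refine ⟨fun h => IsInjector.radical_le_and_isMaximalIn hT h, ?_⟩
  rintro ⟨hFV, hV⟩ N hN
  rw [isMaximalIn_top_iff] at hV
  refine ⟨⟨inf_le_right, ?_⟩, ?_⟩
  · have : Group.IsNilpotent V := hV.1
    exact Group.nilpotent_of_mulEquiv (subgroupOfEquivOfLe (inf_le_left : V ⊓ N ≤ V))
  · rintro U ⟨hUN, hU⟩ hVU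
    refine le_inf (le_of_isNilpotent_of_isSubnormal (hT.radical_mem ⊤) ?_ hV hFV hN hUN hU hVU) hUN
    refine centralizer_le_of_isSolvable fun L hL hLn => ?_
    exact le_radical le_top le_normalizer_of_normal hLn

end FittingSets

/-! ### Passage between `G` and its quotient by the `𝓧`-radical. -/

namespace FittingSets

open Subgroup
open scoped commutatorElement

universe u

variable {G : Type u} [Group G]

theorem isNilpotent_map_mk'_iff {K U : Subgroup G} [K.Normal] :
    Group.IsNilpotent (U.map (QuotientGroup.mk' K)) ↔ ∃ n, U.lowerCentralSeries n ≤ K := by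
  rw [isNilpotent_iff_lowerCentralSeries]
  refine exists_congr fun n => ?_
  rw [← map_lowerCentralSeries, Subgroup.map_eq_bot_iff, QuotientGroup.ker_mk']

theorem map_mk'_le_map_mk'_iff {K U V : Subgroup G} [K.Normal] (hKV : K ≤ V) :
    U.map (QuotientGroup.mk' K) ≤ V.map (QuotientGroup.mk' K) ↔ U ≤ V := by
  rw [map_le_iff_le_comap, QuotientGroup.comap_map_mk', sup_eq_right.2 hKV]

theorem subset_product_nilpotentGroups {𝓧 : Set (Subgroup G)} :
    𝓧 ⊆ product 𝓧 nilpotentGroups := fun _ hS =>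
  mem_product_nilpotentGroups_iff.2 ⟨0, le_radical le_rfl le_normalizer hS⟩

theorem radical_le_radical_of_subset {𝓕 𝓗 : Set (Subgroup G)} (h : 𝓕 ⊆ 𝓗) (M : Subgroup G) :
    radical 𝓕 M ≤ radical 𝓗 M :=
  sSup_le_sSup fun _ hK => ⟨hK.1, hK.2.1, h hK.2.2⟩

/-- If `M / M_𝓧` is soluble, then modulo `M_𝓧` the radical of `M` for `𝓧 ∘ 𝔑` contains its
centralizer. -/
theorem IsFittingSet.mem_radical_product_of_commutatorElement_mem [Finite G]
    {𝓧 : Set (Subgroup G)} (h : IsFittingSet 𝓧) {M : Subgroup G}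
    (hM : M ∈ product 𝓧 solubleGroups) {x : G} (hx : x ∈ M)
    (hcomm : ∀ e ∈ radical (product 𝓧 nilpotentGroups) M, ⁅e, x⁆ ∈ radical 𝓧 M) :
    x ∈ radical (product 𝓧 nilpotentGroups) M := by
  set E := radical (product 𝓧 nilpotentGroups) M with hE
  set π := QuotientGroup.mk' ((radical 𝓧 M).subgroupOf M) with hπ
  have hπs : Function.Surjective π := QuotientGroup.mk'_surjective _
  have : Group.IsSolvable (M ⧸ (radical 𝓧 M).subgroupOf M) := hM
  have hRE : radical 𝓧 M ≤ E :=
    radical_le_radical_of_subset subset_product_nilpotentGroups M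
  have hEn : ((E.subgroupOf M).map π).Normal := Normal.map inferInstance π hπs
  have hcent : centralizer ((E.subgroupOf M).map π : Set (M ⧸ (radical 𝓧 M).subgroupOf M)) ≤
      (E.subgroupOf M).map π := by
    refine centralizer_le_of_isSolvable fun L hL hLnil => ?_
    obtain ⟨n, hn⟩ := (isNilpotent_iff_lowerCentralSeries L).1 hLnil
    set T := (L.comap π).map M.subtype with hT
    have hTM : T ≤ M := map_subtype_le _
    have hTL : T.subgroupOf M = L.comap π :=
      comap_map_eq_self_of_injective M.subtype_injective _
    have hTn : M ≤ normalizer (T : Set G) := by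
      rw [← normal_subgroupOf_iff_le_normalizer hTM, hTL]
      infer_instance
    have hRT : radical 𝓧 M ≤ T := by
      intro r hr
      refine ⟨⟨r, radical_le 𝓧 M hr⟩, ?_, rfl⟩
      have : π ⟨r, radical_le 𝓧 M hr⟩ = 1 := (QuotientGroup.eq_one_iff _).2 hr
      rw [SetLike.mem_coe, mem_comap, this]
      exact L.one_mem
    -- Nilpotency of `L` puts a term of the lower central series of its preimage `T` into `M_𝓧`,
    -- which lies in `T_𝓧`.
    have hTmem : T ∈ product 𝓧 nilpotentGroups := by
      rw [mem_product_nilpotentGroups_iff]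
      refine ⟨n, le_trans ?_ (le_radical hRT (hTM.trans (le_normalizer_radical 𝓧 M))
        (h.radical_mem M))⟩
      rw [hT, ← map_lowerCentralSeries, map_le_iff_le_comap]
      have h1 : ((L.comap π).lowerCentralSeries n).map π = ⊥ := by
        rw [map_lowerCentralSeries, map_comap_eq_self_of_surjective hπs, hn]
      rw [Subgroup.map_eq_bot_iff, hπ, QuotientGroup.ker_mk'] at h1
      exact h1
    have hTE : T ≤ E := le_radical hTM hTn hTmem
    rw [← map_comap_eq_self_of_surjective hπs L, ← hTL]
    exact map_mono (comap_mono hTE)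
  have hxc : π ⟨x, hx⟩ ∈ (E.subgroupOf M).map π := by
    apply hcent
    rw [mem_centralizer_iff]
    rintro _ ⟨e, he, rfl⟩
    have h1 : π ⁅e, ⟨x, hx⟩⁆ = 1 := (QuotientGroup.eq_one_iff _).2 (hcomm e he)
    rw [map_commutatorElement, commutatorElement_eq_one_iff_mul_comm] at h1
    exact h1
  obtain ⟨e, he, hex⟩ := hxc
  have h2 : e⁻¹ * ⟨x, hx⟩ ∈ (radical 𝓧 M).subgroupOf M := QuotientGroup.eq.1 hex
  have h3 := E.mul_mem he (hRE h2)
  simpa using h3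

/-- If `M / M_𝓧` is soluble, a subgroup of `M` containing the radical of `M` for `𝓧 ∘ 𝔑` has its
`𝓧`-radical in that of `M`. -/
theorem IsFittingSet.radical_le_of_radical_product_le [Finite G] {𝓧 : Set (Subgroup G)}
    (h : IsFittingSet 𝓧) {M U : Subgroup G} (hM : M ∈ product 𝓧 solubleGroups) (hUM : U ≤ M)
    (hU : radical (product 𝓧 nilpotentGroups) M ≤ U) : radical 𝓧 U ≤ radical 𝓧 M := by
  set E := radical (product 𝓧 nilpotentGroups) M with hE
  have hEM : E ≤ M := radical_le _ M
  have hME : M ≤ normalizer (E : Set G) := le_normalizer_radical _ M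
  have hD : radical 𝓧 U ⊓ E ≤ radical 𝓧 M := by
    have hUD : U ≤ normalizer ((radical 𝓧 U ⊓ E : Subgroup G) : Set G) :=
      (le_inf (le_normalizer_radical 𝓧 U) (hUM.trans hME)).trans
        (by exact inf_normalizer_le_normalizer_inf)
    have hDE : radical 𝓧 U ⊓ E ≤ radical 𝓧 E :=
      le_radical inf_le_right (hU.trans hUD) (h.mem_of_le_normalizer (h.radical_mem U)
        inf_le_left ((radical_le 𝓧 U).trans hUD))
    rw [h.radical_eq_inf_of_normal hEM hME] at hDE
    exact hDE.trans inf_le_left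
  -- It remains to see `U_𝓧 ≤ E`: both are normalized by each other, so `[E, U_𝓧]` lies in their
  -- intersection, hence in `M_𝓧` by `hD`.
  refine le_trans (le_inf le_rfl fun x hx => ?_) hD
  have hxM : x ∈ M := hUM (radical_le 𝓧 U hx)
  refine h.mem_radical_product_of_commutatorElement_mem hM hxM fun e he => hD ⟨?_, ?_⟩
  · rw [commutatorElement_def]
    exact (radical 𝓧 U).mul_mem (le_normalizer_iff.1 (le_normalizer_radical 𝓧 U) e (hU he) x hx)
      (inv_mem hx)
  · rw [commutatorElement_def, mul_assoc, mul_assoc, ← mul_assoc x]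
    exact E.mul_mem he (le_normalizer_iff.1 hME x hxM _ (inv_mem he))

theorem isSolvable_quotient_radical_top {𝓧 : Set (Subgroup G)}
    (hG : (⊤ : Subgroup G) ∈ product 𝓧 solubleGroups) : Group.IsSolvable (G ⧸ radical 𝓧 ⊤) := by
  have : Group.IsSolvable ((⊤ : Subgroup G) ⧸ (radical 𝓧 ⊤).subgroupOf ⊤) := hG
  refine Group.isSolvable_of_surjective
    (f := QuotientGroup.map ((radical 𝓧 ⊤).subgroupOf ⊤) (radical 𝓧 ⊤) (⊤ : Subgroup G).subtype
      le_rfl) fun y => ?_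
  obtain ⟨g, rfl⟩ := QuotientGroup.mk_surjective y
  exact ⟨QuotientGroup.mk ⟨g, mem_top g⟩, rfl⟩

theorem IsFittingSet.mem_product_solubleGroups_of_isSubnormal [Finite G] {𝓧 : Set (Subgroup G)}
    (h : IsFittingSet 𝓧) (hG : (⊤ : Subgroup G) ∈ product 𝓧 solubleGroups) {N : Subgroup G}
    (hN : N.IsSubnormal) : N ∈ product 𝓧 solubleGroups := by
  have := isSolvable_quotient_radical_top hG
  have hrad := h.radical_eq_inf_of_isSubnormal hN
  refine Group.isSolvable_of_isSolvable_injective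
    (f := QuotientGroup.map ((radical 𝓧 N).subgroupOf N) (radical 𝓧 ⊤) N.subtype
      (comap_mono (hrad.le.trans inf_le_left))) ?_
  rw [injective_iff_map_eq_one]
  intro y hy
  obtain ⟨g, rfl⟩ := QuotientGroup.mk_surjective y
  have hg : (g : G) ∈ radical 𝓧 ⊤ := (QuotientGroup.eq_one_iff _).1 hy
  refine (QuotientGroup.eq_one_iff _).2 ?_
  rw [mem_subgroupOf, hrad]
  exact ⟨hg, g.2⟩

section Quotient

variable [Finite G] {𝓧 : Set (Subgroup G)}

theorem IsFittingSet.mem_product_iff_isNilpotent_map (h : IsFittingSet 𝓧)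
    (hG : (⊤ : Subgroup G) ∈ product 𝓧 solubleGroups) {U : Subgroup G}
    (hU : radical (product 𝓧 nilpotentGroups) ⊤ ≤ U) :
    U ∈ product 𝓧 nilpotentGroups ↔
      Group.IsNilpotent (U.map (QuotientGroup.mk' (radical 𝓧 ⊤))) := by
  have hKU : radical 𝓧 ⊤ ≤ U :=
    (radical_le_radical_of_subset subset_product_nilpotentGroups ⊤).trans hU
  have hrad : radical 𝓧 U = radical 𝓧 ⊤ :=
    le_antisymm (h.radical_le_of_radical_product_le hG le_top hU)
      (le_radical hKU le_normalizer_of_normal (h.radical_mem ⊤))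
  rw [mem_product_nilpotentGroups_iff, isNilpotent_map_mk'_iff, hrad]

theorem IsFittingSet.map_radical_product (h : IsFittingSet 𝓧)
    (hG : (⊤ : Subgroup G) ∈ product 𝓧 solubleGroups) :
    (radical (product 𝓧 nilpotentGroups) ⊤).map (QuotientGroup.mk' (radical 𝓧 ⊤)) =
      radical (trace nilpotentGroups (G ⧸ radical 𝓧 ⊤)) ⊤ := by
  set π := QuotientGroup.mk' (radical 𝓧 (⊤ : Subgroup G)) with hπ
  have hπs : Function.Surjective π := QuotientGroup.mk'_surjective _
  have hH := isFittingSet_product_nilpotentGroups h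
  refine le_antisymm ?_ ?_
  · have : ((radical (product 𝓧 nilpotentGroups) ⊤).map π).Normal :=
      Normal.map inferInstance π hπs
    exact le_radical le_top le_normalizer_of_normal
      ((h.mem_product_iff_isNilpotent_map hG le_rfl).1 (hH.radical_mem ⊤))
  · set F := radical (trace nilpotentGroups (G ⧸ radical 𝓧 (⊤ : Subgroup G))) ⊤ with hF
    have hFnil : Group.IsNilpotent F :=
      (isFittingSet_trace_nilpotentGroups (G ⧸ radical 𝓧 (⊤ : Subgroup G))).radical_mem ⊤
    rw [← map_comap_eq_self_of_surjective hπs F] at hFnil ⊢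
    obtain ⟨n, hn⟩ := isNilpotent_map_mk'_iff.1 hFnil
    refine map_mono (le_radical le_top le_normalizer_of_normal ?_)
    refine mem_product_nilpotentGroups_iff.2 ⟨n, hn.trans (le_radical ?_ le_normalizer_of_normal
      (h.radical_mem ⊤))⟩
    exact QuotientGroup.le_comap_mk' _ _

theorem IsFittingSet.isMaximalIn_map_iff (h : IsFittingSet 𝓧)
    (hG : (⊤ : Subgroup G) ∈ product 𝓧 solubleGroups) {V : Subgroup G}
    (hV : radical (product 𝓧 nilpotentGroups) ⊤ ≤ V) :
    IsMaximalIn (trace nilpotentGroups (G ⧸ radical 𝓧 ⊤)) ⊤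
        (V.map (QuotientGroup.mk' (radical 𝓧 ⊤))) ↔
      IsMaximalIn (product 𝓧 nilpotentGroups) ⊤ V := by
  have hKV : radical 𝓧 ⊤ ≤ V :=
    (radical_le_radical_of_subset subset_product_nilpotentGroups ⊤).trans hV
  have hπs := QuotientGroup.mk'_surjective (radical 𝓧 (⊤ : Subgroup G))
  rw [isMaximalIn_top_iff, isMaximalIn_top_iff]
  constructor
  · rintro ⟨hVn, hmax⟩
    refine ⟨(h.mem_product_iff_isNilpotent_map hG hV).2 hVn, fun U hU hVU => ?_⟩
    rw [← map_mk'_le_map_mk'_iff hKV]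
    exact hmax ((h.mem_product_iff_isNilpotent_map hG (hV.trans hVU)).1 hU) (map_mono hVU)
  · rintro ⟨hVn, hmax⟩
    refine ⟨(h.mem_product_iff_isNilpotent_map hG hV).1 hVn, fun W hW hVW => ?_⟩
    have hVW' := map_le_iff_le_comap.1 hVW
    rw [← map_comap_eq_self_of_surjective hπs W] at hW ⊢
    exact map_mono (hmax ((h.mem_product_iff_isNilpotent_map hG (hV.trans hVW')).2 hW) hVW')

theorem IsFittingSet.radical_le_and_isMaximalIn_iff (h : IsFittingSet 𝓧)
    (hG : (⊤ : Subgroup G) ∈ product 𝓧 solubleGroups) (V : Subgroup G) :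
    radical (product 𝓧 nilpotentGroups) ⊤ ≤ V ∧ IsMaximalIn (product 𝓧 nilpotentGroups) ⊤ V ↔
      radical 𝓧 ⊤ ≤ V ∧ IsNilpotentInjector (V.map (QuotientGroup.mk' (radical 𝓧 ⊤))) := by
  have := isSolvable_quotient_radical_top hG
  have hKE := radical_le_radical_of_subset
    (subset_product_nilpotentGroups (𝓧 := 𝓧)) ⊤
  rw [isNilpotentInjector_iff, ← h.map_radical_product hG]
  constructor
  · rintro ⟨hE, hmax⟩
    exact ⟨hKE.trans hE, map_mono hE, (h.isMaximalIn_map_iff hG hE).2 hmax⟩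
  · rintro ⟨hK, hE, hmax⟩
    rw [map_mk'_le_map_mk'_iff hK] at hE
    exact ⟨hE, (h.isMaximalIn_map_iff hG hE).1 hmax⟩

theorem IsFittingSet.isInjector_product_of_map (h : IsFittingSet 𝓧)
    (hG : (⊤ : Subgroup G) ∈ product 𝓧 solubleGroups) {V : Subgroup G} (hKV : radical 𝓧 ⊤ ≤ V)
    (hV : IsNilpotentInjector (V.map (QuotientGroup.mk' (radical 𝓧 ⊤)))) :
    IsInjector (product 𝓧 nilpotentGroups) V := by
  intro N hN
  have hH := isFittingSet_product_nilpotentGroups h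
  obtain ⟨hEV, hmax⟩ := (h.radical_le_and_isMaximalIn_iff hG V).2 ⟨hKV, hV⟩
  have hrad := h.radical_eq_inf_of_isSubnormal hN
  refine ⟨⟨inf_le_right, ?_⟩, ?_⟩
  · obtain ⟨n, hn⟩ := isNilpotent_map_mk'_iff.1
      ((h.mem_product_iff_isNilpotent_map hG hEV).1 (isMaximalIn_top_iff.1 hmax).1)
    refine mem_product_nilpotentGroups_iff.2 ⟨n, le_trans ?_ (le_radical (K := radical 𝓧 N) ?_
      (inf_le_right.trans (le_normalizer_radical 𝓧 N)) (h.radical_mem N))⟩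
    · rw [hrad]
      exact le_inf ((lowerCentralSeries_mono n inf_le_left).trans hn)
        ((lowerCentralSeries_le_self _ n).trans inf_le_right)
    · rw [hrad]
      exact inf_le_inf_right N hKV
  · rintro U ⟨hUN, hU⟩ hVU
    have hEU : radical (product 𝓧 nilpotentGroups) N ≤ U := by
      rw [hH.radical_eq_inf_of_isSubnormal hN]
      exact (inf_le_inf_right N hEV).trans hVU
    -- `N` inherits solubility modulo its `𝓧`-radical, so the key fact inside `N` gives `U_𝓧 ≤ N_𝓧 ≤
    -- G_𝓧`, and the image of `U` is nilpotent.
    have hradU := h.radical_le_of_radical_product_le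
      (h.mem_product_solubleGroups_of_isSubnormal hG hN) hUN hEU
    obtain ⟨n, hn⟩ := mem_product_nilpotentGroups_iff.1 hU
    have hUnil : Group.IsNilpotent (U.map (QuotientGroup.mk' (radical 𝓧 (⊤ : Subgroup G)))) :=
      isNilpotent_map_mk'_iff.2 ⟨n, hn.trans (hradU.trans (hrad.le.trans inf_le_left))⟩
    have hle := (hV (N.map (QuotientGroup.mk' (radical 𝓧 ⊤))) hN.quotient).2
      ⟨map_mono hUN, hUnil⟩ (by
        -- As `V` contains the kernel, a common image of `v ∈ V` and `m ∈ N` comes from `m ∈ V ∩ N`.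
        rintro _ ⟨⟨v, hv, rfl⟩, ⟨m, hm, hmv⟩⟩
        refine ⟨m, hVU ⟨?_, hm⟩, hmv⟩
        have hk : v⁻¹ * m ∈ radical 𝓧 (⊤ : Subgroup G) := QuotientGroup.eq.1 hmv.symm
        simpa using V.mul_mem hv (hKV hk))
    exact le_inf ((map_mk'_le_map_mk'_iff hKV).1 (hle.trans inf_le_left)) hUN

end Quotient

end FittingSets

open FittingSets in
theorem corollary4p1 {G : Type*} [Group G] [Finite G] (𝓧 : Set (Subgroup G))
    (h𝓧 : IsFittingSet 𝓧) (hG : (⊤ : Subgroup G) ∈ product 𝓧 solubleGroups) :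
    IsFittingSet (product 𝓧 nilpotentGroups) ∧
    (∀ V : Subgroup G,
      IsInjector (product 𝓧 nilpotentGroups) V ↔
        radical 𝓧 ⊤ ≤ V ∧
          IsNilpotentInjector (V.map (QuotientGroup.mk' (radical 𝓧 (⊤ : Subgroup G))))) ∧
    {V : Subgroup G | IsInjector (product 𝓧 nilpotentGroups) V} =
      {V : Subgroup G | radical (product 𝓧 nilpotentGroups) ⊤ ≤ V ∧
        IsMaximalIn (product 𝓧 nilpotentGroups) ⊤ V} := by
  have hH := isFittingSet_product_nilpotentGroups h𝓧
  have hiff : ∀ V : Subgroup G, IsInjector (product 𝓧 nilpotentGroups) V ↔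
      radical 𝓧 ⊤ ≤ V ∧
        IsNilpotentInjector (V.map (QuotientGroup.mk' (radical 𝓧 (⊤ : Subgroup G)))) := fun V =>
    ⟨fun hV => (h𝓧.radical_le_and_isMaximalIn_iff hG V).1
        (IsInjector.radical_le_and_isMaximalIn hH hV),
      fun hV => h𝓧.isInjector_product_of_map hG hV.1 hV.2⟩
  refine ⟨hH, hiff, Set.ext fun V => ?_⟩
  exact (hiff V).trans (h𝓧.radical_le_and_isMaximalIn_iff hG V).symm
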